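/- Theorem. Let $d \ge 0$ be an integer and let $\Omega \subset \mathbb{R}^d$ be a bounded, open, convex set of Lebesgue measure $1$ that is non-symmetric, i.e. there is no point $x_0 \in \mathbb{R}^d$ such that $y \in \Omega$ implies $2x_0 - y \in \Omega$. Then $\Omega$ is not spectral: there is no set $\Lambda \subset \mathbb{R}^d$ such that the exponentials $e_\lambda(x) = e^{2\pi i \langle \lambda, x\rangle}$, $\lambda \in \Lambda$, restricted to $\Omega$, form an orthonormal basis of the complex Hilbert space $L^2(\Omega)$ (with inner product $\langle f,g\rangle_\Omega = \int_\Omega f\overline{g}$). -/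

import Mathlib

open MeasureTheory

/-- The exponential `e_l(x) = exp (2 π i ⟨l, x⟩)` on `ℝ^d`. -/
noncomputable def expChar {d : ℕ} (l x : EuclideanSpace ℝ (Fin d)) : ℂ :=
  Complex.exp (2 * (Real.pi : ℂ) * Complex.I * ((inner ℝ l x : ℝ) : ℂ))

/-- `(Ω, Λ)` is a spectral pair: the exponentials `e_l`, `l ∈ Λ`, restricted to `Ω`, form an
orthonormal basis (in the Hilbert space sense) of the complex space `L²(Ω)`. -/
def IsSpectralPair {d : ℕ} (Ω Λ : Set (EuclideanSpace ℝ (Fin d))) : Prop :=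
  ∃ b : HilbertBasis Λ ℂ (Lp ℂ 2 (volume.restrict Ω)),
    ∀ l : Λ, (b l : EuclideanSpace ℝ (Fin d) → ℂ) =ᵐ[volume.restrict Ω]
      expChar (l : EuclideanSpace ℝ (Fin d))

/-- `Ω` is spectral if it has a spectrum. -/
def IsSpectral {d : ℕ} (Ω : Set (EuclideanSpace ℝ (Fin d))) : Prop :=
  ∃ Λ : Set (EuclideanSpace ℝ (Fin d)), IsSpectralPair Ω Λ

/-- `Ω` is symmetric with respect to the point `x₀`. -/
def IsSymmetricAbout {d : ℕ} (Ω : Set (EuclideanSpace ℝ (Fin d)))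
    (x₀ : EuclideanSpace ℝ (Fin d)) : Prop :=
  ∀ y ∈ Ω, (2 : ℝ) • x₀ - y ∈ Ω

/-- `Ω` is non-symmetric: it is not symmetric with respect to any point. -/
def IsNonSymmetric {d : ℕ} (Ω : Set (EuclideanSpace ℝ (Fin d))) : Prop :=
  ∀ x₀ : EuclideanSpace ℝ (Fin d), ¬ IsSymmetricAbout Ω x₀

/-! Apply Parseval to the indicators of two equal balls inside Ω, modulated by a frequency `m`. With
B the ball of radius r at 0, the squared Fourier coefficients, weighted by the phase of the
displacement s of the centres, sum to the overlap volume |B ∩ (B + s)|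
(`IsSpectralPair.hasSum_expChar_sub`). Suppose every element of K − K is such a displacement, and
integrate over K × K. Each term becomes nonnegative, the zero-frequency term is |B|²|K|², and the
overlaps integrate to at most |B|²|K|, so |K| ≤ 1 (`IsSpectralPair.volume_real_le_one`). Taking for
K slightly shrunken copies of (Ω − Ω)/2 is allowed by convexity, and gives |(Ω − Ω)/2| ≤ 1 = |Ω|.

This forces equality in Brunn–Minkowski for Ω and −Ω. Slicing along a linear functional u reduces
the equality case to the one-dimensional Prékopa–Leindler inequality, whose proof by transport of
quantiles shows that the marginal density is symmetric (`exists_symm_of_lintegral_le`). So u(Ω) is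
symmetric about the u-value of the centroid for every u ≠ 0, and Hahn–Banach makes the centroid a
centre of symmetry of Ω (`exists_center_of_measure_midpoint_le`). -/

section Exponentials

/-! ### Characters and Parseval's identity on balls. -/

variable {d : ℕ}

local notation "𝔼" => EuclideanSpace ℝ (Fin d)

lemma expChar_add_right (l x y : 𝔼) : expChar l (x + y) = expChar l x * expChar l y := by
  simp only [expChar, ← Complex.exp_add, inner_add_right]
  congr 1; push_cast; ring

lemma expChar_sub_left (l m x : 𝔼) :
    expChar (l - m) x = (starRingEnd ℂ) (expChar m x) * expChar l x := by
  simp only [expChar, ← Complex.exp_conj, ← Complex.exp_add, inner_sub_left]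
  congr 1; simp [map_ofNat]; ring

lemma conj_expChar (l x : 𝔼) : (starRingEnd ℂ) (expChar l x) = expChar l (-x) := by
  simp only [expChar, ← Complex.exp_conj, inner_neg_right]
  congr 1; simp [map_ofNat]

@[simp] lemma expChar_zero_left (x : 𝔼) : expChar 0 x = 1 := by simp [expChar]

@[simp] lemma expChar_zero_right (l : 𝔼) : expChar l 0 = 1 := by simp [expChar]

@[simp] lemma norm_expChar (l x : 𝔼) : ‖expChar l x‖ = 1 := by
  rw [expChar, show (2 * (Real.pi : ℂ) * Complex.I * ((inner ℝ l x : ℝ) : ℂ))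
    = ((2 * Real.pi * inner ℝ l x : ℝ) : ℂ) * Complex.I by push_cast; ring]
  exact Complex.norm_exp_ofReal_mul_I _

@[fun_prop] lemma continuous_expChar (l : 𝔼) : Continuous (expChar l) := by
  unfold expChar; fun_prop

lemma memLp_indicator_ball_expChar {Ω : Set 𝔼} (hfin : volume Ω ≠ ⊤) (l a : 𝔼) (r : ℝ) :
    MemLp ((Metric.ball a r).indicator (expChar l)) 2 (volume.restrict Ω) := by
  have : IsFiniteMeasure (volume.restrict Ω) := ⟨by simpa using hfin.lt_top⟩
  refine MemLp.of_bound (C := 1) ?_ ?_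
  · exact ((continuous_expChar l).measurable.indicator measurableSet_ball).aestronglyMeasurable
  · refine Filter.Eventually.of_forall fun x => ?_
    refine (norm_indicator_le_norm_self _ _).trans (by simp)

lemma setIntegral_ball_expChar (l a : 𝔼) (r : ℝ) :
    ∫ x in Metric.ball a r, expChar l x = expChar l a * ∫ x in Metric.ball 0 r, expChar l x := by
  rw [← integral_indicator measurableSet_ball, ← integral_indicator measurableSet_ball,
    ← integral_const_mul, ← integral_add_left_eq_self _ a]
  congr 1; ext x
  by_cases hx : x ∈ Metric.ball (0 : 𝔼) r
  · rw [Set.indicator_of_mem hx, Set.indicator_of_mem (by simpa using hx), expChar_add_right]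
  · rw [Set.indicator_of_notMem hx, Set.indicator_of_notMem (by simpa using hx), mul_zero]

/-- Parseval's identity for the spectrum, tested on two modulated indicators of balls. -/
lemma IsSpectralPair.hasSum_expChar_sub {Ω Λ : Set 𝔼} (hfin : volume Ω ≠ ⊤)
    (h : IsSpectralPair Ω Λ) (m a b : 𝔼) {r : ℝ} (ha : Metric.ball a r ⊆ Ω)
    (hb : Metric.ball b r ⊆ Ω) :
    HasSum (fun l : Λ => ((‖∫ x in Metric.ball 0 r, expChar (m - (l : 𝔼)) x‖ ^ 2 : ℝ) : ℂ)
        * expChar (m - (l : 𝔼)) (b - a))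
      ((volume.real (Metric.ball (0 : 𝔼) r ∩ Metric.ball (b - a) r) : ℝ) : ℂ) := by
  obtain ⟨B, hB⟩ := h
  set f : 𝔼 → Lp ℂ 2 (volume.restrict Ω) := fun a =>
    (memLp_indicator_ball_expChar hfin m a r).toLp _ with hf
  have hfa : ∀ a, f a =ᵐ[volume.restrict Ω] (Metric.ball a r).indicator (expChar m) :=
    fun a => MemLp.coeFn_toLp _
  have hcoef : ∀ a, Metric.ball a r ⊆ Ω → ∀ l : Λ, inner ℂ (B l) (f a)
      = expChar (m - (l : 𝔼)) a * ∫ x in Metric.ball 0 r, expChar (m - (l : 𝔼)) x := by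
    intro a ha l
    rw [L2.inner_def, ← setIntegral_ball_expChar]
    have : (fun x => inner ℂ (B l x) (f a x)) =ᵐ[volume.restrict Ω]
        (Metric.ball a r).indicator (expChar (m - (l : 𝔼))) := by
      filter_upwards [hB l, hfa a] with x h1 h2
      rw [h1, h2]
      by_cases hx : x ∈ Metric.ball a r
      · simp [Set.indicator_of_mem hx, expChar_sub_left, mul_comm]
      · simp [Set.indicator_of_notMem hx]
    rw [integral_congr_ae this, setIntegral_indicator measurableSet_ball,
      Set.inter_eq_self_of_subset_right ha]
  have hin : inner ℂ (f a) (f b)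
      = ((volume.real (Metric.ball (0 : 𝔼) r ∩ Metric.ball (b - a) r) : ℝ) : ℂ) := by
    rw [L2.inner_def]
    have : (fun x => inner ℂ (f a x) (f b x)) =ᵐ[volume.restrict Ω]
        (Metric.ball a r ∩ Metric.ball b r).indicator (fun _ => (1 : ℂ)) := by
      filter_upwards [hfa a, hfa b] with x h1 h2
      rw [h1, h2]
      by_cases hx : x ∈ Metric.ball a r <;> by_cases hy : x ∈ Metric.ball b r <;>
        simp [Set.indicator, hx, hy, -Metric.mem_ball]
    rw [integral_congr_ae this,
      setIntegral_indicator (measurableSet_ball.inter measurableSet_ball),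
      Set.inter_eq_self_of_subset_right (Set.inter_subset_left.trans ha)]
    have htr : Metric.ball a r ∩ Metric.ball b r
        = (fun x => -a + x) ⁻¹' (Metric.ball (0 : 𝔼) r ∩ Metric.ball (b - a) r) := by
      ext x
      simp only [Set.mem_inter_iff, Metric.mem_ball, Set.mem_preimage, dist_eq_norm, sub_zero]
      rw [show -a + x = x - a by abel, show x - a - (b - a) = x - b by abel]
    have hvol : volume.real (Metric.ball a r ∩ Metric.ball b r)
        = volume.real (Metric.ball (0 : 𝔼) r ∩ Metric.ball (b - a) r) := by
      rw [htr, measureReal_def, measure_preimage_add, measureReal_def]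
    rw [← hvol]
    simp
  have := B.hasSum_inner_mul_inner (f a) (f b)
  rw [hin] at this
  have hterm : ∀ l : Λ, inner ℂ (f a) (B l) * inner ℂ (B l) (f b)
      = ((‖∫ x in Metric.ball 0 r, expChar (m - (l : 𝔼)) x‖ ^ 2 : ℝ) : ℂ)
        * expChar (m - (l : 𝔼)) (b - a) := by
    intro l
    -- The phases at `a` and `b` combine into one at `b - a`; the two equal ball integrals give a
    -- squared modulus.
    rw [← inner_conj_symm, hcoef a ha, hcoef b hb, sub_eq_add_neg b a, expChar_add_right,
      ← conj_expChar, map_mul, Complex.ofReal_pow, ← Complex.conj_mul']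
    ring
  simp_rw [hterm] at this
  exact this

end Exponentials

/-! ### Averaging Parseval over K × K. -/

section Exponentials

variable {d : ℕ}

local notation "𝔼" => EuclideanSpace ℝ (Fin d)

lemma measurableSet_mem_ball_inter (r : ℝ) :
    MeasurableSet {p : 𝔼 × 𝔼 | p.2 ∈ Metric.ball (0 : 𝔼) r ∩ Metric.ball p.1 r} := by
  have h1 : IsOpen {p : 𝔼 × 𝔼 | dist p.2 0 < r} := isOpen_lt (by fun_prop) (by fun_prop)
  have h2 : IsOpen {p : 𝔼 × 𝔼 | dist p.2 p.1 < r} := isOpen_lt (by fun_prop) (by fun_prop)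
  exact (h1.inter h2).measurableSet

lemma measurable_measure_ball_inter (r : ℝ) :
    Measurable fun t : 𝔼 => volume (Metric.ball (0 : 𝔼) r ∩ Metric.ball t r) :=
  measurable_measure_prodMk_left (measurableSet_mem_ball_inter r)

/-- Tonelli: for fixed `y` in the ball at 0, the centres `t` whose ball contains `y` fill the ball
of radius `r` at `y`. -/
lemma lintegral_volume_ball_inter (r : ℝ) :
    ∫⁻ t : 𝔼, volume (Metric.ball (0 : 𝔼) r ∩ Metric.ball t r)
      = volume (Metric.ball (0 : 𝔼) r) * volume (Metric.ball (0 : 𝔼) r) := by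
  have hset := measurableSet_mem_ball_inter (d := d) r
  have h1 := Measure.prod_apply (μ := (volume : Measure 𝔼)) (ν := (volume : Measure 𝔼)) hset
  have h2 := Measure.prod_apply_symm (μ := (volume : Measure 𝔼)) (ν := (volume : Measure 𝔼)) hset
  have h3 : ∀ t : 𝔼, Prod.mk t ⁻¹' {p : 𝔼 × 𝔼 | p.2 ∈ Metric.ball (0 : 𝔼) r ∩ Metric.ball p.1 r}
      = Metric.ball (0 : 𝔼) r ∩ Metric.ball t r := fun t => rfl
  simp only [h3] at h1
  rw [← h1, h2]
  have h4 : ∀ y : 𝔼, volume ((fun x => (x, y)) ⁻¹'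
      {p : 𝔼 × 𝔼 | p.2 ∈ Metric.ball (0 : 𝔼) r ∩ Metric.ball p.1 r})
      = (Metric.ball (0 : 𝔼) r).indicator (fun _ => volume (Metric.ball (0 : 𝔼) r)) y := by
    intro y
    by_cases hy : y ∈ Metric.ball (0 : 𝔼) r
    · rw [Set.indicator_of_mem hy, ← Measure.addHaar_ball_center volume y r]
      congr 1; ext x
      rw [Metric.mem_ball] at hy
      simp [-dist_zero_right, hy, dist_comm]
    · rw [Set.indicator_of_notMem hy]
      convert measure_empty (μ := (volume : Measure 𝔼))
      ext x
      simp only [Set.mem_preimage, Set.mem_ofPred_eq, Set.mem_inter_iff, hy, false_and,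
        Set.mem_empty_iff_false]
  simp_rw [h4]
  rw [lintegral_indicator measurableSet_ball, lintegral_const, Measure.restrict_apply_univ]

/-- For a fixed first variable, the integral over the second is enlarged from `K` to the whole
space, where it is the squared volume of the ball. -/
lemma integral_prod_ball_inter_le (r : ℝ) {K : Set 𝔼} (hKfin : volume K ≠ ⊤) :
    ∫ p, volume.real (Metric.ball (0 : 𝔼) r ∩ Metric.ball (p.1 - p.2) r)
      ∂((volume.restrict K).prod (volume.restrict K))
      ≤ volume.real K * volume.real (Metric.ball (0 : 𝔼) r) ^ 2 := by
  have hfinB : ∀ t : 𝔼, volume (Metric.ball (0 : 𝔼) r ∩ Metric.ball t r) ≠ ⊤ := fun t =>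
    ((measure_mono Set.inter_subset_left).trans_lt measure_ball_lt_top).ne
  have hmE := measurable_measure_ball_inter (d := d) r
  have hmE2 : Measurable fun p : 𝔼 × 𝔼 =>
      volume (Metric.ball (0 : 𝔼) r ∩ Metric.ball (p.1 - p.2) r) :=
    hmE.comp (measurable_fst.sub measurable_snd)
  have hm : Measurable fun p : 𝔼 × 𝔼 =>
      volume.real (Metric.ball (0 : 𝔼) r ∩ Metric.ball (p.1 - p.2) r) := hmE2.ennreal_toReal
  rw [integral_eq_lintegral_of_nonneg_ae (Filter.Eventually.of_forall fun _ => measureReal_nonneg)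
    hm.aestronglyMeasurable]
  have key : ∫⁻ p, ENNReal.ofReal (volume.real (Metric.ball (0 : 𝔼) r ∩ Metric.ball (p.1 - p.2) r))
      ∂((volume.restrict K).prod (volume.restrict K))
      ≤ volume K * (volume (Metric.ball (0 : 𝔼) r) * volume (Metric.ball (0 : 𝔼) r)) := by
    simp_rw [measureReal_def, fun p : 𝔼 × 𝔼 => ENNReal.ofReal_toReal (hfinB (p.1 - p.2))]
    rw [lintegral_prod _ hmE2.aemeasurable]
    calc _ ≤ ∫⁻ _ in K, (volume (Metric.ball (0 : 𝔼) r) * volume (Metric.ball (0 : 𝔼) r)) := by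
          refine lintegral_mono fun x => ?_
          refine (setLIntegral_le_lintegral _ _).trans ?_
          rw [← lintegral_volume_ball_inter]
          exact (lintegral_sub_left_eq_self (μ := volume)
            (fun t : 𝔼 => volume (Metric.ball (0 : 𝔼) r ∩ Metric.ball t r)) x).le
      _ = _ := by rw [lintegral_const, Measure.restrict_apply_univ, mul_comm]
  refine (ENNReal.toReal_mono ?_ key).trans ?_
  · exact ENNReal.mul_ne_top hKfin (ENNReal.mul_ne_top measure_ball_lt_top.ne measure_ball_lt_top.ne)
  · simp [measureReal_def, pow_two]

/-- The kernel factors as a character times a conjugate character. The result is nonnegative when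
`c` is, so all terms but one of the averaged Parseval sum can be dropped. -/
lemma integral_prod_expChar_sub (K : Set 𝔼) (l : 𝔼) (c : ℝ) :
    ∫ p, (c : ℂ) * expChar l (p.1 - p.2) ∂((volume.restrict K).prod (volume.restrict K))
      = ((c * ‖∫ s in K, expChar l s‖ ^ 2 : ℝ) : ℂ) := by
  rw [integral_const_mul]
  simp_rw [sub_eq_add_neg, expChar_add_right, ← conj_expChar]
  rw [integral_prod_mul (expChar l) (fun t => (starRingEnd ℂ) (expChar l t)), integral_conj,
    Complex.mul_conj']
  push_cast; ring

/-- If all differences of points of `K` are differences of centres of balls of radius `r` contained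
in the spectral set `Ω`, then `K` has volume at most one. -/
lemma IsSpectralPair.volume_real_le_one {Ω Λ : Set 𝔼} (hfin : volume Ω ≠ ⊤)
    (h : IsSpectralPair Ω Λ) {r : ℝ} (hr : 0 < r) {K : Set 𝔼} (hKfin : volume K ≠ ⊤)
    (hK : ∀ s ∈ K, ∀ t ∈ K, ∃ a b, Metric.ball a r ⊆ Ω ∧ Metric.ball b r ⊆ Ω ∧ s - t = b - a)
    (hKm : MeasurableSet K) : volume.real K ≤ 1 := by
  rcases K.eq_empty_or_nonempty with rfl | ⟨s₀, hs₀⟩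
  · simp
  set v := volume.real (Metric.ball (0 : 𝔼) r) with hv
  have hvpos : 0 < v := ENNReal.toReal_pos (Metric.measure_ball_pos _ _ hr).ne'
    measure_ball_lt_top.ne
  set c : 𝔼 → 𝔼 → ℝ := fun m l => ‖∫ x in Metric.ball 0 r, expChar (m - l) x‖ ^ 2 with hc
  have hsum : ∀ m : 𝔼, ∀ s ∈ K, ∀ t ∈ K,
      HasSum (fun l : Λ => ((c m l : ℝ) : ℂ) * expChar ((m : 𝔼) - (l : 𝔼)) (s - t))
      ((volume.real (Metric.ball (0 : 𝔼) r ∩ Metric.ball (s - t) r) : ℝ) : ℂ) := by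
    intro m s hs t ht
    obtain ⟨a, b, ha, hb, hab⟩ := hK s hs t ht
    rw [hab]
    exact h.hasSum_expChar_sub hfin m a b ha hb
  have hsum0 : ∀ m : 𝔼, HasSum (fun l : Λ => c m l) v := by
    intro m
    have := hsum m s₀ hs₀ s₀ hs₀
    simp only [sub_self, expChar_zero_right, mul_one, Set.inter_self] at this
    exact_mod_cast this
  have hne : Nonempty Λ := by
    by_contra hcon
    rw [not_nonempty_iff] at hcon
    exact hvpos.ne (hasSum_empty.unique (hsum0 0))
  -- Modulating by an element of the spectrum makes frequency zero occur in the sum, at `l = m`.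
  obtain ⟨m⟩ := hne
  have hcm : c m m = v ^ 2 := by
    simp [hc, hv, measureReal_def]
  have hc0 : ∀ l, 0 ≤ c m l := fun l => sq_nonneg _
  -- Exchanging sum and integral needs a countable index; `Λ` is not known to be countable, but the
  -- support of a summable family is.
  set S : Set Λ := Function.support fun l : Λ => c m l with hS
  have hScount : Countable S := (hsum0 m).summable.countable_support.to_subtype
  have hfK : IsFiniteMeasure (volume.restrict K) := ⟨by simpa using hKfin.lt_top⟩
  set ν := (volume.restrict K).prod (volume.restrict K) with hν
  have hae : ∀ᵐ p ∂ν, p.1 ∈ K ∧ p.2 ∈ K := by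
    rw [hν, Measure.prod_restrict]
    exact ae_restrict_mem (hKm.prod hKm)
  have hint : HasSum (fun l : S => ∫ p, ((c m l : ℝ) : ℂ) * expChar ((m : 𝔼) - (l : 𝔼)) (p.1 - p.2) ∂ν)
      (∫ p, ((volume.real (Metric.ball (0 : 𝔼) r ∩ Metric.ball (p.1 - p.2) r) : ℝ) : ℂ) ∂ν) := by
    refine hasSum_integral_of_dominated_convergence (fun l _ => c m l) ?_ ?_ ?_ ?_ ?_
    · intro l
      exact (Continuous.aestronglyMeasurable (by fun_prop))
    · intro l
      refine Filter.Eventually.of_forall fun p => ?_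
      simp [abs_of_nonneg (hc0 _)]
    · exact Filter.Eventually.of_forall fun p => (hsum0 m).summable.subtype S
    · exact integrable_const _
    · filter_upwards [hae] with p hp
      refine (hasSum_subtype_iff_of_support_subset ?_).mpr (hsum m p.1 hp.1 p.2 hp.2)
      intro l hl hl'
      exact hl (by simp only at hl' ⊢; rw [hl']; simp)
  rw [integral_complex_ofReal] at hint
  simp_rw [hν, integral_prod_expChar_sub] at hint
  rw [Complex.hasSum_ofReal] at hint
  have hmS : m ∈ S := by
    simp only [hS, Function.mem_support, hcm]; positivity
  have hle := le_hasSum hint ⟨m, hmS⟩ fun l _ => mul_nonneg (hc0 _) (sq_nonneg _)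
  have hle2 := hle.trans (integral_prod_ball_inter_le r hKfin)
  have hmm : ‖∫ s in K, expChar ((m : 𝔼) - (m : 𝔼)) s‖ = volume.real K := by
    simp [measureReal_def]
  simp only [hcm, hmm] at hle2
  rw [← hv] at hle2
  by_contra! hgt
  have hv2 : 0 < v ^ 2 := by positivity
  nlinarith [mul_pos (mul_pos hv2 (sub_pos.mpr hgt)) (by linarith : 0 < volume.real K)]

end Exponentials

/-! ### One-dimensional Prékopa–Leindler by quantile transport, with an equality case. -/

section Quantile

open Set Filter Topology

lemma setIntegral_Ioo_pos {f : ℝ → ℝ} {a b : ℝ} (hab : a < b) (hpos : ∀ x ∈ Ioo a b, 0 < f x)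
    (hint : IntegrableOn f (Ioo a b)) : 0 < ∫ x in Ioo a b, f x := by
  rw [setIntegral_pos_iff_support_of_nonneg_ae]
  · have : Function.support f ∩ Ioo a b = Ioo a b :=
      inter_eq_right.mpr fun x hx => (hpos x hx).ne'
    rw [this]; simpa using hab
  · filter_upwards [ae_restrict_mem measurableSet_Ioo] with x hx using (hpos x hx).le
  · exact hint

/-- Quantile function of a positive continuous density on a bounded interval. -/
lemma exists_quantile {f : ℝ → ℝ} {a b V : ℝ} (hab : a < b) (hf : ContinuousOn f (Ioo a b))
    (hpos : ∀ x ∈ Ioo a b, 0 < f x) (hint : IntegrableOn f (Ioo a b))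
    (hV : ∫ x in Ioo a b, f x = V) :
    ∃ p : ℝ → ℝ, MapsTo p (Ioo 0 1) (Ioo a b) ∧ SurjOn p (Ioo 0 1) (Ioo a b) ∧
      StrictMonoOn p (Ioo 0 1) ∧ ∀ m ∈ Ioo (0 : ℝ) 1, HasDerivAt p (V / f (p m)) m := by
  have hV0 : 0 < V := hV ▸ setIntegral_Ioo_pos hab hpos hint
  set M : ℝ → ℝ := fun x => (∫ t in a..x, f t) / V with hM
  have hint' : IntegrableOn f (uIcc a b) := by
    rwa [uIcc_of_le hab.le, integrableOn_Icc_iff_integrableOn_Ioo]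
  have hcont : ContinuousOn M (Icc a b) := by
    have := intervalIntegral.continuousOn_primitive_interval hint'
    rw [uIcc_of_le hab.le] at this
    exact this.div_const _
  have hder : ∀ x ∈ Ioo a b, HasDerivAt M (f x / V) x := by
    intro x hx
    refine HasDerivAt.div_const ?_ _
    refine intervalIntegral.integral_hasDerivAt_right ?_ ?_ (hf.continuousAt (Ioo_mem_nhds hx.1 hx.2))
    · refine (hint'.mono_set ?_).intervalIntegrable
      rw [uIcc_of_le hx.1.le, uIcc_of_le hab.le]
      exact Icc_subset_Icc_right hx.2.le
    · exact hf.stronglyMeasurableAtFilter isOpen_Ioo x hx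
  have hmono : StrictMonoOn M (Icc a b) := by
    refine strictMonoOn_of_deriv_pos (convex_Icc a b) hcont fun x hx => ?_
    rw [interior_Icc] at hx
    rw [(hder x hx).deriv]
    exact div_pos (hpos x hx) hV0
  have hMa : M a = 0 := by simp [hM]
  have hMb : M b = 1 := by
    rw [hM]; simp only
    rw [intervalIntegral.integral_of_le hab.le, integral_Ioc_eq_integral_Ioo, hV, div_self hV0.ne']
  have hsurj : SurjOn M (Ioo a b) (Ioo 0 1) := by
    have := intermediate_value_Ioo hab.le hcont
    rwa [hMa, hMb] at this
  have hmaps : MapsTo M (Ioo a b) (Ioo 0 1) := by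
    intro x hx
    have h1 := hmono (left_mem_Icc.mpr hab.le) (Ioo_subset_Icc_self hx) hx.1
    have h2 := hmono (Ioo_subset_Icc_self hx) (right_mem_Icc.mpr hab.le) hx.2
    rw [hMa] at h1; rw [hMb] at h2
    exact ⟨h1, h2⟩
  have hmono' := hmono.mono Ioo_subset_Icc_self
  set p := Function.invFunOn M (Ioo a b) with hp
  have hpm : MapsTo p (Ioo 0 1) (Ioo a b) := hsurj.mapsTo_invFunOn
  have hMp : ∀ m ∈ Ioo (0 : ℝ) 1, M (p m) = m := hsurj.rightInvOn_invFunOn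
  have hps : SurjOn p (Ioo 0 1) (Ioo a b) := fun x hx =>
    ⟨M x, hmaps hx, hmono'.injOn.leftInvOn_invFunOn hx⟩
  have hpmono : StrictMonoOn p (Ioo 0 1) := by
    intro m hm n hn hmn
    rw [← hmono'.lt_iff_lt (hpm hm) (hpm hn), hMp m hm, hMp n hn]
    exact hmn
  refine ⟨p, hpm, hps, hpmono, fun m hm => ?_⟩
  have hc : ContinuousAt p m := by
    refine hpmono.continuousAt_of_image_mem_nhds (Ioo_mem_nhds hm.1 hm.2) ?_
    rw [hps.image_eq_of_mapsTo hpm]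
    exact Ioo_mem_nhds (hpm hm).1 (hpm hm).2
  have := HasDerivAt.of_local_left_inverse hc (hder _ (hpm hm))
    (div_pos (hpos _ (hpm hm)) hV0).ne'
    (by filter_upwards [Ioo_mem_nhds hm.1 hm.2] with y hy using hMp y hy)
  rwa [inv_div] at this

/-- The integral of a function along a convex combination of two quantile functions. -/
lemma lintegral_quantile_le {p q p' q' : ℝ → ℝ} {w : ℝ} (hw0 : 0 < w) (hw1 : w < 1)
    (hp : StrictMonoOn p (Ioo 0 1)) (hq : StrictMonoOn q (Ioo 0 1))
    (hp' : ∀ m ∈ Ioo (0 : ℝ) 1, HasDerivAt p (p' m) m)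
    (hq' : ∀ m ∈ Ioo (0 : ℝ) 1, HasDerivAt q (q' m) m)
    {h : ℝ → ENNReal} {k : ℝ → ℝ} (hk0 : ∀ m ∈ Ioo (0 : ℝ) 1, 0 ≤ k m)
    (hk : ∀ m ∈ Ioo (0 : ℝ) 1, ENNReal.ofReal (k m) ≤ h ((1 - w) * p m + w * q m)) :
    ∫⁻ m in Ioo (0 : ℝ) 1, ENNReal.ofReal (k m * ((1 - w) * p' m + w * q' m)) ≤ ∫⁻ x, h x := by
  set z : ℝ → ℝ := fun m => (1 - w) * p m + w * q m with hz
  have hzmono : StrictMonoOn z (Ioo 0 1) := by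
    intro m hm n hn hmn
    have h1 := mul_lt_mul_of_pos_left (hp hm hn hmn) (sub_pos.mpr hw1)
    have h2 := mul_lt_mul_of_pos_left (hq hm hn hmn) hw0
    simp only [hz]; linarith
  have hzd : ∀ m ∈ Ioo (0 : ℝ) 1, HasDerivAt z ((1 - w) * p' m + w * q' m) m := fun m hm =>
    ((hp' m hm).const_mul _).add ((hq' m hm).const_mul _)
  calc _ ≤ ∫⁻ m in Ioo (0 : ℝ) 1, ENNReal.ofReal |(1 - w) * p' m + w * q' m| * h (z m) := by
        refine setLIntegral_mono' measurableSet_Ioo fun m hm => ?_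
        rw [mul_comm (k m)]
        calc _ ≤ ENNReal.ofReal (|(1 - w) * p' m + w * q' m| * k m) :=
              ENNReal.ofReal_le_ofReal (mul_le_mul_of_nonneg_right (le_abs_self _) (hk0 m hm))
          _ = ENNReal.ofReal |(1 - w) * p' m + w * q' m| * ENNReal.ofReal (k m) :=
              ENNReal.ofReal_mul (abs_nonneg _)
          _ ≤ _ := mul_le_mul_right (hk m hm) _
    _ = ∫⁻ x in z '' Ioo 0 1, h x := by
        rw [lintegral_image_eq_lintegral_abs_deriv_mul measurableSet_Ioo
          (fun m hm => (hzd m hm).hasDerivWithinAt) hzmono.injOn]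
    _ ≤ ∫⁻ x, h x := setLIntegral_le_lintegral _ _

/-- Weighted AM–GM for `V / f` and `W / g`: the pointwise bound on the transported integrand. -/
lemma rpow_mul_rpow_le_mul_add {f g V W w : ℝ} (hf : 0 < f) (hg : 0 < g) (hV : 0 ≤ V) (hW : 0 ≤ W)
    (hw0 : 0 < w) (hw1 : w < 1) :
    V ^ (1 - w) * W ^ w ≤ f ^ (1 - w) * g ^ w * ((1 - w) * (V / f) + w * (W / g)) := by
  have h1 := Real.geom_mean_le_arith_mean2_weighted (sub_pos.mpr hw1).le hw0.le
    (div_nonneg hV hf.le) (div_nonneg hW hg.le) (by ring)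
  have hfw := Real.rpow_pos_of_pos hf (1 - w)
  have hgw := Real.rpow_pos_of_pos hg w
  have h2 := mul_le_mul_of_nonneg_left h1 (mul_pos hfw hgw).le
  rw [Real.div_rpow hV hf.le, Real.div_rpow hW hg.le] at h2
  refine le_trans (le_of_eq ?_) h2
  field_simp

/-- One-dimensional Prékopa–Leindler inequality for continuous densities on intervals. -/
lemma rpow_mul_rpow_le_lintegral {f g : ℝ → ℝ} {a b c e V W w : ℝ} (hab : a < b) (hce : c < e)
    (hf : ContinuousOn f (Ioo a b)) (hfpos : ∀ x ∈ Ioo a b, 0 < f x)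
    (hfint : IntegrableOn f (Ioo a b)) (hV : ∫ x in Ioo a b, f x = V)
    (hg : ContinuousOn g (Ioo c e)) (hgpos : ∀ x ∈ Ioo c e, 0 < g x)
    (hgint : IntegrableOn g (Ioo c e)) (hW : ∫ x in Ioo c e, g x = W)
    (hw0 : 0 < w) (hw1 : w < 1) {h : ℝ → ENNReal}
    (hh : ∀ s ∈ Ioo a b, ∀ t ∈ Ioo c e,
      ENNReal.ofReal (f s ^ (1 - w) * g t ^ w) ≤ h ((1 - w) * s + w * t)) :
    ENNReal.ofReal (V ^ (1 - w) * W ^ w) ≤ ∫⁻ x, h x := by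
  obtain ⟨p, hpm, -, hpmono, hpd⟩ := exists_quantile hab hf hfpos hfint hV
  obtain ⟨q, hqm, -, hqmono, hqd⟩ := exists_quantile hce hg hgpos hgint hW
  have hV0 : 0 ≤ V := hV ▸ setIntegral_nonneg measurableSet_Ioo fun x hx => (hfpos x hx).le
  have hW0 : 0 ≤ W := hW ▸ setIntegral_nonneg measurableSet_Ioo fun x hx => (hgpos x hx).le
  refine le_trans ?_ (lintegral_quantile_le hw0 hw1 hpmono hqmono hpd hqd
    (k := fun m => f (p m) ^ (1 - w) * g (q m) ^ w) (fun m hm => ?_)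
    (fun m hm => hh _ (hpm hm) _ (hqm hm)))
  · calc _ = ∫⁻ _ in Ioo (0 : ℝ) 1, ENNReal.ofReal (V ^ (1 - w) * W ^ w) := by simp
      _ ≤ _ := setLIntegral_mono' measurableSet_Ioo fun m hm => ENNReal.ofReal_le_ofReal <|
        rpow_mul_rpow_le_mul_add (hfpos _ (hpm hm)) (hgpos _ (hqm hm)) hV0 hW0 hw0 hw1
  · exact mul_nonneg (Real.rpow_nonneg (hfpos _ (hpm hm)).le _)
      (Real.rpow_nonneg (hgpos _ (hqm hm)).le _)

/-- Equality in AM–GM: in terms of the square roots of `x` and `y`, the hypothesis says that the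
square of their difference vanishes. -/
lemma eq_of_rpow_half_mul_add_eq {x y V : ℝ} (hx : 0 < x) (hy : 0 < y) (hV : 0 < V)
    (h : x ^ (1 - 1 / 2 : ℝ) * y ^ (1 / 2 : ℝ)
      * ((1 - 1 / 2) * (V / x) + 1 / 2 * (V / y)) = V) : x = y := by
  rw [show (1 - 1 / 2 : ℝ) = 1 / 2 by norm_num, ← Real.sqrt_eq_rpow, ← Real.sqrt_eq_rpow] at h
  obtain ⟨s, hs, rfl⟩ : ∃ s : ℝ, 0 < s ∧ x = s ^ 2 :=
    ⟨√x, Real.sqrt_pos.mpr hx, (Real.sq_sqrt hx.le).symm⟩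
  obtain ⟨t, ht, rfl⟩ : ∃ t : ℝ, 0 < t ∧ y = t ^ 2 :=
    ⟨√y, Real.sqrt_pos.mpr hy, (Real.sq_sqrt hy.le).symm⟩
  rw [Real.sqrt_sq hs.le, Real.sqrt_sq ht.le] at h
  field_simp at h
  have : (s - t) ^ 2 = 0 := by linarith
  rw [sub_eq_zero.mp (pow_eq_zero_iff two_ne_zero |>.mp this)]

/-- Equality case of the one-dimensional Prékopa–Leindler inequality for a density and its
reflection: the density is symmetric. -/
lemma exists_symm_of_lintegral_le {f : ℝ → ℝ} {a b V : ℝ} (hab : a < b)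
    (hf : ContinuousOn f (Ioo a b)) (hfpos : ∀ x ∈ Ioo a b, 0 < f x)
    (hfint : IntegrableOn f (Ioo a b)) (hV : ∫ x in Ioo a b, f x = V) {h : ℝ → ENNReal}
    (hh : ∀ s ∈ Ioo a b, ∀ t ∈ Ioo a b,
      ENNReal.ofReal (f s ^ (1 - 1 / 2 : ℝ) * f t ^ (1 / 2 : ℝ)) ≤ h ((1 - 1 / 2) * s + 1 / 2 * (-t)))
    (hle : ∫⁻ x, h x ≤ ENNReal.ofReal V) :
    ∀ x ∈ Ioo a b, a + b - x ∈ Ioo a b ∧ f (a + b - x) = f x := by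
  obtain ⟨p, hpm, hps, hpmono, hpd⟩ := exists_quantile hab hf hfpos hfint hV
  have hV0 : 0 < V := hV ▸ setIntegral_Ioo_pos hab hfpos hfint
  have hrefl : ∀ m ∈ Ioo (0 : ℝ) 1, 1 - m ∈ Ioo (0 : ℝ) 1 := fun m hm =>
    ⟨by linarith [hm.2], by linarith [hm.1]⟩
  -- `-p (1 - m)` is the quantile function of the reflected density.
  have hpd' : ∀ m ∈ Ioo (0 : ℝ) 1, HasDerivAt (fun m => -p (1 - m)) (V / f (p (1 - m))) m := by
    intro m hm
    have := ((hpd _ (hrefl m hm)).comp_const_sub 1 m).fun_neg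
    rwa [neg_neg] at this
  set k : ℝ → ℝ := fun m => f (p m) ^ (1 - 1 / 2 : ℝ) * f (p (1 - m)) ^ (1 / 2 : ℝ) with hk
  set J : ℝ → ℝ := fun m => k m * ((1 - 1 / 2) * (V / f (p m)) + 1 / 2 * (V / f (p (1 - m)))) with hJ
  have hup : ∫⁻ m in Ioo (0 : ℝ) 1, ENNReal.ofReal (J m) ≤ ENNReal.ofReal V := by
    refine (lintegral_quantile_le (p := p) (q := fun m => -p (1 - m)) (by norm_num) (by norm_num)
      hpmono ?_ hpd hpd' (h := h) ?_ ?_).trans hle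
    · intro m hm n hn hmn
      have := hpmono (hrefl n hn) (hrefl m hm) (by linarith)
      simpa using this
    · intro m hm
      exact mul_nonneg (Real.rpow_nonneg (hfpos _ (hpm hm)).le _)
        (Real.rpow_nonneg (hfpos _ (hpm (hrefl m hm))).le _)
    · exact fun m hm => hh _ (hpm hm) _ (hpm (hrefl m hm))
  have hlow : ∀ m ∈ Ioo (0 : ℝ) 1, V ≤ J m := by
    intro m hm
    have := rpow_mul_rpow_le_mul_add (w := 1 / 2) (hfpos _ (hpm hm)) (hfpos _ (hpm (hrefl m hm)))
      hV0.le hV0.le (by norm_num) (by norm_num)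
    rwa [← Real.rpow_add hV0, sub_add_cancel, Real.rpow_one] at this
  have hpc : ContinuousOn p (Ioo 0 1) := fun m hm => (hpd m hm).continuousAt.continuousWithinAt
  have hfp : ContinuousOn (fun m => f (p m)) (Ioo 0 1) := hf.comp hpc hpm
  have hfp' : ContinuousOn (fun m => f (p (1 - m))) (Ioo 0 1) :=
    hfp.comp (f := fun m => 1 - m) (by fun_prop) hrefl
  have hJc : ContinuousOn J (Ioo 0 1) := by
    refine ((hfp.rpow_const fun m hm => Or.inl (hfpos _ (hpm hm)).ne').mul
      (hfp'.rpow_const fun m hm => Or.inl (hfpos _ (hpm (hrefl m hm))).ne')).mul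
      ((continuousOn_const.mul (continuousOn_const.div hfp ?_)).add
      (continuousOn_const.mul (continuousOn_const.div hfp' ?_)))
    · exact fun m hm => (hfpos _ (hpm hm)).ne'
    · exact fun m hm => (hfpos _ (hpm (hrefl m hm))).ne'
  have hae : J =ᵐ[volume.restrict (Ioo 0 1)] fun _ => V := by
    have hJm : AEMeasurable (fun m => ENNReal.ofReal (J m)) (volume.restrict (Ioo 0 1)) :=
      (hJc.aemeasurable measurableSet_Ioo).ennreal_ofReal
    have h1 : (fun _ => ENNReal.ofReal V) =ᵐ[volume.restrict (Ioo (0 : ℝ) 1)]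
        fun m => ENNReal.ofReal (J m) := by
      refine ae_eq_of_ae_le_of_lintegral_le ?_ (by simp) hJm (by simpa using hup)
      filter_upwards [ae_restrict_mem measurableSet_Ioo] with m hm
      exact ENNReal.ofReal_le_ofReal (hlow m hm)
    filter_upwards [h1, ae_restrict_mem measurableSet_Ioo] with m hm hm'
    exact ((ENNReal.ofReal_eq_ofReal_iff hV0.le (hV0.le.trans (hlow m hm'))).mp hm).symm
  -- The bounds `V ≤ J` pointwise and integral at most `V` give equality almost everywhere;
  -- continuity makes it hold everywhere.
  have hJeq : EqOn J (fun _ => V) (Ioo 0 1) :=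
    Measure.eqOn_open_of_ae_eq hae isOpen_Ioo hJc continuousOn_const
  have hff : ∀ m ∈ Ioo (0 : ℝ) 1, f (p m) = f (p (1 - m)) := fun m hm =>
    eq_of_rpow_half_mul_add_eq (hfpos _ (hpm hm)) (hfpos _ (hpm (hrefl m hm))) hV0 (hJeq hm)
  obtain ⟨κ, hκ⟩ : ∃ κ, ∀ m ∈ Ioo (0 : ℝ) 1, p m + p (1 - m) = κ := by
    have hd : ∀ m ∈ Ioo (0 : ℝ) 1, HasDerivAt (fun m => p m - (-p (1 - m))) 0 m := by
      intro m hm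
      have := (hpd m hm).sub (hpd' m hm)
      rwa [← hff m hm, sub_self] at this
    refine ⟨p (1 / 2) - (-p (1 - 1 / 2)), fun m hm => ?_⟩
    have := isOpen_Ioo.is_const_of_deriv_eq_zero isPreconnected_Ioo
      (fun m hm => (hd m hm).differentiableAt.differentiableWithinAt)
      (fun m hm => (hd m hm).deriv) hm (show (1 / 2 : ℝ) ∈ Ioo (0 : ℝ) 1 by norm_num)
    linarith
  have hsym : ∀ x ∈ Ioo a b, κ - x ∈ Ioo a b ∧ f (κ - x) = f x := by
    intro x hx
    obtain ⟨m, hm, rfl⟩ := hps hx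
    rw [← hκ m hm, add_sub_cancel_left]
    exact ⟨hpm (hrefl m hm), (hff m hm).symm⟩
  have hκab : κ = a + b := by
    -- The reflection maps the interval onto itself, so comparing suprema identifies `κ`.
    have himg : (fun x => κ - x) '' Ioo a b = Ioo a b := by
      refine Subset.antisymm (image_subset_iff.mpr fun x hx => (hsym x hx).1) fun x hx => ?_
      exact ⟨κ - x, (hsym x hx).1, by simp⟩
    rw [image_const_sub_Ioo] at himg
    have := congrArg sSup himg
    rw [csSup_Ioo (by linarith), csSup_Ioo hab] at this
    linarith
  rwa [hκab] at hsym

end Quantile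

/-! ### Brunn–Minkowski by induction on dimension, and symmetry of marginals. -/

section BrunnMinkowski

set_option linter.unusedSectionVars false

open Set Filter Topology Bornology
open scoped Pointwise

lemma IsOpen.eq_Ioo_of_convex {S : Set ℝ} (hS : IsOpen S) (hc : Convex ℝ S) (hb : IsBounded S)
    (hne : S.Nonempty) : ∃ a b, a < b ∧ S = Ioo a b := by
  have hbb := hb.bddBelow
  have hba := hb.bddAbove
  have hsub : S ⊆ Ioo (sInf S) (sSup S) := by
    intro x hx
    obtain ⟨ε, hε, hball⟩ := Metric.isOpen_iff.mp hS x hx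
    have h1 : x - ε / 2 ∈ S := hball (by simp [abs_of_pos hε, hε])
    have h2 : x + ε / 2 ∈ S := hball (by simp [abs_of_pos hε, hε])
    exact ⟨by linarith [csInf_le hbb h1], by linarith [le_csSup hba h2]⟩
  obtain ⟨x, hx⟩ := hne
  exact ⟨sInf S, sSup S, (hsub hx).1.trans (hsub hx).2,
    hsub.antisymm ((hc.isConnected ⟨x, hx⟩).Ioo_csInf_csSup_subset hbb hba)⟩

/-- The multiplicative Brunn–Minkowski inequality on bounded open convex sets. -/
def SatisfiesBrunnMinkowski {E : Type*} [NormedAddCommGroup E] [NormedSpace ℝ E]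
    [MeasurableSpace E] (μ : Measure E) : Prop :=
  ∀ ⦃A B : Set E⦄, IsOpen A → Convex ℝ A → IsBounded A → A.Nonempty →
    IsOpen B → Convex ℝ B → IsBounded B → B.Nonempty → ∀ ⦃w : ℝ⦄, 0 < w → w < 1 →
    μ.real A ^ (1 - w) * μ.real B ^ w ≤ μ.real ((1 - w) • A + w • B)

lemma IsBounded.smul_add_smul {E : Type*} [NormedAddCommGroup E] [NormedSpace ℝ E] {A B : Set E}
    (hA : IsBounded A) (hB : IsBounded B) (s t : ℝ) : IsBounded (s • A + t • B) :=
  (hA.smul₀ s).add (hB.smul₀ t)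

lemma IsOpen.smul_add_smul {E : Type*} [NormedAddCommGroup E] [NormedSpace ℝ E] {A B : Set E}
    (hA : IsOpen A) {s : ℝ} (hs : s ≠ 0) (t : ℝ) : IsOpen (s • A + t • B) :=
  (hA.smul₀ hs).add_right

section Slices

variable {F : Type*} [NormedAddCommGroup F] [NormedSpace ℝ F]

lemma convex_slice {A : Set (ℝ × F)} (hA : Convex ℝ A) (s : ℝ) : Convex ℝ (Prod.mk s ⁻¹' A) := by
  intro x hx y hy α β hα hβ hαβ
  have := hA hx hy hα hβ hαβ
  simpa [← add_mul, hαβ] using this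

lemma isOpen_slice {A : Set (ℝ × F)} (hA : IsOpen A) (s : ℝ) : IsOpen (Prod.mk s ⁻¹' A) :=
  hA.preimage (by fun_prop)

lemma isBounded_slice {A : Set (ℝ × F)} (hA : IsBounded A) (s : ℝ) :
    IsBounded (Prod.mk s ⁻¹' A) :=
  hA.image_snd.subset fun y hy => ⟨(s, y), hy, rfl⟩

lemma nonempty_slice {A : Set (ℝ × F)} {s : ℝ} (hs : s ∈ Prod.fst '' A) :
    (Prod.mk s ⁻¹' A).Nonempty := by
  obtain ⟨⟨_, y⟩, h, rfl⟩ := hs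
  exact ⟨y, h⟩

lemma smul_slice_add_smul_slice_subset (A B : Set (ℝ × F)) (α β s t : ℝ) :
    α • (Prod.mk s ⁻¹' A) + β • (Prod.mk t ⁻¹' B)
      ⊆ Prod.mk (α * s + β * t) ⁻¹' (α • A + β • B) := by
  rintro _ ⟨_, ⟨x, hx, rfl⟩, _, ⟨y, hy, rfl⟩, rfl⟩
  exact ⟨α • (s, x), ⟨_, hx, rfl⟩, β • (t, y), ⟨_, hy, rfl⟩, by simp⟩

variable [MeasurableSpace F] [BorelSpace F] [FiniteDimensional ℝ F] {μ : Measure F}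
  [μ.IsAddHaarMeasure]

lemma measureReal_slice_pos {A : Set (ℝ × F)} (hA : IsOpen A) (hb : IsBounded A) {s : ℝ}
    (hs : s ∈ Prod.fst '' A) : 0 < μ.real (Prod.mk s ⁻¹' A) :=
  ENNReal.toReal_pos ((isOpen_slice hA s).measure_pos μ (nonempty_slice hs)).ne'
    (isBounded_slice hb s).measure_lt_top.ne

lemma measureReal_slice_eq_zero {A : Set (ℝ × F)} {s : ℝ} (hs : s ∉ Prod.fst '' A) :
    μ.real (Prod.mk s ⁻¹' A) = 0 := by
  have : Prod.mk s ⁻¹' A = ∅ := by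
    ext y
    simp only [mem_preimage, mem_empty_iff_false, iff_false]
    exact fun h => hs ⟨_, h, rfl⟩
  simp [this]

lemma SatisfiesBrunnMinkowski.rpow_slice_le (hμ : SatisfiesBrunnMinkowski μ) {A B : Set (ℝ × F)}
    (hA : IsOpen A) (hAc : Convex ℝ A) (hAb : IsBounded A)
    (hB : IsOpen B) (hBc : Convex ℝ B) (hBb : IsBounded B) {w : ℝ} (hw0 : 0 < w) (hw1 : w < 1)
    {s t : ℝ} (hs : s ∈ Prod.fst '' A) (ht : t ∈ Prod.fst '' B) :
    μ.real (Prod.mk s ⁻¹' A) ^ (1 - w) * μ.real (Prod.mk t ⁻¹' B) ^ w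
      ≤ μ.real (Prod.mk ((1 - w) * s + w * t) ⁻¹' ((1 - w) • A + w • B)) := by
  refine (hμ (isOpen_slice hA s) (convex_slice hAc s) (isBounded_slice hAb s) (nonempty_slice hs)
    (isOpen_slice hB t) (convex_slice hBc t) (isBounded_slice hBb t) (nonempty_slice ht)
    hw0 hw1).trans ?_
  exact measureReal_mono (smul_slice_add_smul_slice_subset A B _ _ s t)
    (isBounded_slice (IsBounded.smul_add_smul hAb hBb _ _) _).measure_lt_top.ne

/-- Brunn–Minkowski on the slices makes the slice volume log-concave, and a concave function is
continuous on an open interval. -/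
lemma SatisfiesBrunnMinkowski.continuousOn_slice (hμ : SatisfiesBrunnMinkowski μ)
    {A : Set (ℝ × F)} (hA : IsOpen A) (hAc : Convex ℝ A) (hAb : IsBounded A) :
    ContinuousOn (fun s => μ.real (Prod.mk s ⁻¹' A)) (Prod.fst '' A) := by
  have hpos : ∀ s ∈ Prod.fst '' A, 0 < μ.real (Prod.mk s ⁻¹' A) := fun s hs =>
    measureReal_slice_pos hA hAb hs
  have hconc : ConcaveOn ℝ (Prod.fst '' A) fun s => Real.log (μ.real (Prod.mk s ⁻¹' A)) := by
    rw [concaveOn_iff_forall_pos]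
    refine ⟨hAc.linear_image (LinearMap.fst ℝ ℝ F), fun x hx y hy α β hα hβ hαβ => ?_⟩
    obtain rfl : α = 1 - β := by linarith
    have h := hμ.rpow_slice_le hA hAc hAb hA hAc hAb hβ (by linarith) hx hy
    rw [← hAc.add_smul hα.le hβ.le, sub_add_cancel, one_smul] at h
    have h2 := Real.log_le_log (mul_pos (Real.rpow_pos_of_pos (hpos x hx) _)
      (Real.rpow_pos_of_pos (hpos y hy) _)) h
    rw [Real.log_mul (Real.rpow_pos_of_pos (hpos x hx) _).ne'
      (Real.rpow_pos_of_pos (hpos y hy) _).ne', Real.log_rpow (hpos x hx),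
      Real.log_rpow (hpos y hy)] at h2
    simpa using h2
  have hc := (hconc.continuousOn (isOpenMap_fst _ hA)).rexp
  exact hc.congr fun s hs => (Real.exp_log (hpos s hs)).symm

lemma prod_apply_eq_lintegral_slice {A : Set (ℝ × F)} (hA : IsOpen A) :
    ((volume : Measure ℝ).prod μ) A = ∫⁻ s, μ (Prod.mk s ⁻¹' A) := by
  exact Measure.prod_apply hA.measurableSet

lemma integrable_slice {A : Set (ℝ × F)} (hA : IsOpen A) (hAb : IsBounded A) :
    Integrable fun s => μ.real (Prod.mk s ⁻¹' A) :=
  Measure.integrable_measure_prodMk_left hA.measurableSet hAb.measure_lt_top.ne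

lemma integral_slice {A : Set (ℝ × F)} (hA : IsOpen A) (hAb : IsBounded A) :
    ∫ s, μ.real (Prod.mk s ⁻¹' A) = ((volume : Measure ℝ).prod μ).real A := by
  rw [measureReal_def, prod_apply_eq_lintegral_slice hA]
  refine integral_toReal ?_ ?_
  · exact (measurable_measure_prodMk_left hA.measurableSet).aemeasurable
  · exact Filter.Eventually.of_forall fun s => (isBounded_slice hAb s).measure_lt_top

lemma setIntegral_slice {A : Set (ℝ × F)} (hA : IsOpen A) (hAb : IsBounded A) {S : Set ℝ}
    (hS : Prod.fst '' A = S) :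
    ∫ s in S, μ.real (Prod.mk s ⁻¹' A) = ((volume : Measure ℝ).prod μ).real A := by
  rw [← integral_slice hA hAb, setIntegral_eq_integral_of_forall_compl_eq_zero]
  exact fun s hs => measureReal_slice_eq_zero (hS ▸ hs)

/-- Induction step: slice volumes satisfy the Prékopa–Leindler hypothesis, and their integrals are
the volumes of the bodies. -/
lemma SatisfiesBrunnMinkowski.prod (hμ : SatisfiesBrunnMinkowski μ) :
    SatisfiesBrunnMinkowski ((volume : Measure ℝ).prod μ) := by
  intro A B hA hAc hAb hAne hB hBc hBb hBne w hw0 hw1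
  obtain ⟨a, b, hab, hIA⟩ := (isOpenMap_fst _ hA).eq_Ioo_of_convex
    (hAc.linear_image (LinearMap.fst ℝ ℝ F)) hAb.image_fst (hAne.image _)
  obtain ⟨c, e, hce, hIB⟩ := (isOpenMap_fst _ hB).eq_Ioo_of_convex
    (hBc.linear_image (LinearMap.fst ℝ ℝ F)) hBb.image_fst (hBne.image _)
  have hCb := IsBounded.smul_add_smul hAb hBb (1 - w) w
  have hCo : IsOpen ((1 - w) • A + w • B) := hA.smul_add_smul (by linarith) w
  have key := rpow_mul_rpow_le_lintegral hab hce
    (hIA ▸ hμ.continuousOn_slice hA hAc hAb) (fun x hx => measureReal_slice_pos hA hAb (hIA ▸ hx))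
    (integrable_slice hA hAb).integrableOn (setIntegral_slice hA hAb hIA)
    (hIB ▸ hμ.continuousOn_slice hB hBc hBb) (fun x hx => measureReal_slice_pos hB hBb (hIB ▸ hx))
    (integrable_slice hB hBb).integrableOn (setIntegral_slice hB hBb hIB) hw0 hw1
    (h := fun s => μ (Prod.mk s ⁻¹' ((1 - w) • A + w • B))) (fun s hs t ht => by
      rw [ENNReal.ofReal_le_iff_le_toReal (isBounded_slice hCb _).measure_lt_top.ne]
      exact hμ.rpow_slice_le hA hAc hAb hB hBc hBb hw0 hw1 (hIA ▸ hs) (hIB ▸ ht))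
  rw [← prod_apply_eq_lintegral_slice hCo,
    ENNReal.ofReal_le_iff_le_toReal hCb.measure_lt_top.ne] at key
  exact key

/-- Equality in the Brunn–Minkowski inequality for `A` and `-A` forces the first marginal of `A`
to be symmetric. -/
lemma SatisfiesBrunnMinkowski.exists_symm_fst (hμ : SatisfiesBrunnMinkowski μ) {A : Set (ℝ × F)}
    (hA : IsOpen A) (hAc : Convex ℝ A) (hAb : IsBounded A) (hAne : A.Nonempty)
    (hle : ((volume : Measure ℝ).prod μ) ((1 / 2 : ℝ) • A + (1 / 2 : ℝ) • (-A))
      ≤ ((volume : Measure ℝ).prod μ) A) :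
    ∃ κ : ℝ, (∀ z ∈ A, κ - z.1 ∈ Prod.fst '' A) ∧
      2 * ∫ z in A, z.1 ∂((volume : Measure ℝ).prod μ)
        = κ * ((volume : Measure ℝ).prod μ).real A := by
  obtain ⟨a, b, hab, hI⟩ := (isOpenMap_fst _ hA).eq_Ioo_of_convex
    (hAc.linear_image (LinearMap.fst ℝ ℝ F)) hAb.image_fst (hAne.image _)
  have hCb := IsBounded.smul_add_smul hAb hAb.neg (1 / 2) (1 / 2)
  have hCo : IsOpen ((1 / 2 : ℝ) • A + (1 / 2 : ℝ) • (-A)) := hA.smul_add_smul (by norm_num) _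
  have hneg : ∀ t, μ.real (Prod.mk (-t) ⁻¹' (-A)) = μ.real (Prod.mk t ⁻¹' A) := by
    intro t
    have : Prod.mk (-t) ⁻¹' (-A) = -(Prod.mk t ⁻¹' A) := by ext y; simp
    rw [this, measureReal_def, Measure.measure_neg, measureReal_def]
  have hsymm := exists_symm_of_lintegral_le hab
    (hI ▸ hμ.continuousOn_slice hA hAc hAb) (fun x hx => measureReal_slice_pos hA hAb (hI ▸ hx))
    (integrable_slice hA hAb).integrableOn (setIntegral_slice hA hAb hI)
    (h := fun s => μ (Prod.mk s ⁻¹' ((1 / 2 : ℝ) • A + (1 / 2 : ℝ) • (-A)))) (fun s hs t ht => by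
      rw [ENNReal.ofReal_le_iff_le_toReal (isBounded_slice hCb _).measure_lt_top.ne, ← hneg t]
      have ht' : -t ∈ Prod.fst '' (-A) := by
        rw [← hI] at ht
        obtain ⟨z, hz, rfl⟩ := ht
        exact ⟨-z, by simpa using hz, rfl⟩
      have := hμ.rpow_slice_le hA hAc hAb hA.neg hAc.neg hAb.neg (w := 1 / 2) (by norm_num)
        (by norm_num) (hI ▸ hs) ht'
      refine this.trans (le_of_eq ?_)
      rw [show (1 - 1 / 2 : ℝ) = 1 / 2 by norm_num]
      rfl)
    (by rw [← prod_apply_eq_lintegral_slice hCo, measureReal_def,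
          ENNReal.ofReal_toReal hAb.measure_lt_top.ne]
        exact hle)
  set f : ℝ → ℝ := fun s => μ.real (Prod.mk s ⁻¹' A) with hf
  have hfsymm : ∀ x, f (a + b - x) = f x := by
    intro x
    by_cases hx : x ∈ Ioo a b
    · exact (hsymm x hx).2
    · rw [hf]
      simp only
      have hx' : a + b - x ∉ Ioo a b := fun h => hx (by have := (hsymm _ h).1; rwa [sub_sub_cancel] at this)
      rw [measureReal_slice_eq_zero (hI ▸ hx'), measureReal_slice_eq_zero (hI ▸ hx)]
  have hid : IntegrableOn (fun z : ℝ × F => z.1) A ((volume : Measure ℝ).prod μ) := by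
    have : IsCompact (closure A) := hAb.isCompact_closure
    exact (continuous_fst.continuousOn.integrableOn_compact this).mono_set subset_closure
  have hmoment : ∫ z in A, z.1 ∂((volume : Measure ℝ).prod μ) = ∫ s, s * f s := by
    rw [← integral_indicator hA.measurableSet,
      integral_prod _ ((integrable_indicator_iff hA.measurableSet).mpr hid)]
    congr 1; ext s
    have : (fun y => A.indicator (fun z : ℝ × F => z.1) (s, y))
        = (Prod.mk s ⁻¹' A).indicator fun _ => s := by ext y; rfl
    rw [this, integral_indicator_const _ (isOpen_slice hA s).measurableSet, smul_eq_mul, mul_comm]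
  have hfi : Integrable f := integrable_slice hA hAb
  have hsf : Integrable fun s => s * f s := by
    have h2 := ((integrable_indicator_iff hA.measurableSet).mpr hid).integral_prod_left
    refine h2.congr (Filter.Eventually.of_forall fun s => ?_)
    have : (fun y => A.indicator (fun z : ℝ × F => z.1) (s, y))
        = (Prod.mk s ⁻¹' A).indicator fun _ => s := by ext y; rfl
    simp only
    rw [this, integral_indicator_const _ (isOpen_slice hA s).measurableSet, smul_eq_mul, mul_comm]
  refine ⟨a + b, fun z hz => hI ▸ (hsymm z.1 (hI ▸ mem_image_of_mem _ hz)).1, ?_⟩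
  rw [hmoment, ← integral_slice hA hAb]
  -- Reflecting the variable expresses the first moment through itself, which places the mean at `(a
  -- + b) / 2`.
  have h1 : ∫ s, s * f s = ∫ s, (a + b - s) * f s := by
    rw [← integral_sub_left_eq_self (fun s => s * f s) volume (a + b)]
    simp_rw [hfsymm]
  have h2 : ∫ s, (a + b - s) * f s = (a + b) * (∫ s, f s) - ∫ s, s * f s := by
    simp_rw [sub_mul]
    rw [integral_sub (hfi.const_mul _) hsf, integral_const_mul]
  have h3 : ∫ s, μ.real (Prod.mk s ⁻¹' A) = ∫ s, f s := rfl
  rw [h3]; linarith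

end Slices

section Transfer

variable {E E' : Type*} [NormedAddCommGroup E] [NormedSpace ℝ E] [MeasurableSpace E] [BorelSpace E]
  [FiniteDimensional ℝ E] [NormedAddCommGroup E'] [NormedSpace ℝ E'] [MeasurableSpace E']
  [BorelSpace E'] [FiniteDimensional ℝ E'] (μ : Measure E) [μ.IsAddHaarMeasure]
  (ν : Measure E') [ν.IsAddHaarMeasure]

lemma exists_map_eq_smul (e : E ≃L[ℝ] E') : ∃ c : NNReal, c ≠ 0 ∧ μ.map e = c • ν := by
  have : (μ.map e).IsAddHaarMeasure := e.isAddHaarMeasure_map μ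
  exact ⟨_, (Measure.addHaarScalarFactor_pos_of_isAddHaarMeasure _ _).ne',
    Measure.isAddLeftInvariant_eq_smul _ _⟩

lemma image_smul_add_smul (e : E ≃L[ℝ] E') (A B : Set E) (s t : ℝ) :
    e '' (s • A + t • B) = s • (e '' A) + t • (e '' B) := by
  rw [image_add e, image_smul_comm e s A fun x => map_smul e s x,
    image_smul_comm e t B fun x => map_smul e t x]

lemma measure_eq_mul_of_map_eq {μ : Measure E} {ν : Measure E'} {e : E ≃L[ℝ] E'} {c : NNReal}
    (h : μ.map e = c • ν) (S : Set E) : μ S = c * ν (e '' S) := by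
  have h2 := e.toHomeomorph.measurableEmbedding.map_apply μ (e '' S)
  have h3 : (e.toHomeomorph : E → E') = e := rfl
  rw [h3, h, preimage_image_eq _ e.injective] at h2
  rw [← h2]; rfl

/-- Haar measures correspond up to a factor `c`, which cancels because the exponents `1 - w` and `w`
sum to one. -/
lemma SatisfiesBrunnMinkowski.of_equiv {ν : Measure E'} [ν.IsAddHaarMeasure]
    (hν : SatisfiesBrunnMinkowski ν) (e : E ≃L[ℝ] E') : SatisfiesBrunnMinkowski μ := by
  obtain ⟨c, hc, h⟩ := exists_map_eq_smul μ ν e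
  have hreal : ∀ S : Set E, μ.real S = c * ν.real (e '' S) := by
    intro S
    rw [measureReal_def, measure_eq_mul_of_map_eq h, ENNReal.toReal_mul]; rfl
  have hc0 : (0 : ℝ) < c := by positivity
  intro A B hA hAc hAb hAne hB hBc hBb hBne w hw0 hw1
  rw [hreal, hreal, hreal, image_smul_add_smul, Real.mul_rpow hc0.le measureReal_nonneg,
    Real.mul_rpow hc0.le measureReal_nonneg, mul_mul_mul_comm, ← Real.rpow_add hc0,
    sub_add_cancel, Real.rpow_one]
  refine mul_le_mul_of_nonneg_left ?_ hc0.le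
  have hbd : ∀ S : Set E, IsBounded S → IsBounded (e '' S) := fun S hS =>
    e.lipschitz.isBounded_image hS
  exact hν (e.toHomeomorph.isOpenMap _ hA) (hAc.linear_image e.toLinearMap) (hbd _ hAb)
    (hAne.image _) (e.toHomeomorph.isOpenMap _ hB) (hBc.linear_image e.toLinearMap) (hbd _ hBb)
    (hBne.image _) hw0 hw1

lemma satisfiesBrunnMinkowski_of_subsingleton [Subsingleton E] : SatisfiesBrunnMinkowski μ := by
  intro A B hA hAc hAb hAne hB hBc hBb hBne w hw0 hw1
  obtain rfl := hAne.eq_univ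
  obtain rfl := hBne.eq_univ
  have h := (((univ_nonempty (α := E)).smul_set (a := 1 - w)).add
    ((univ_nonempty (α := E)).smul_set (a := w))).eq_univ
  have hpos : 0 < μ.real univ := ENNReal.toReal_pos (isOpen_univ.measure_pos μ univ_nonempty).ne'
    hAb.measure_lt_top.ne
  rw [h, ← Real.rpow_add hpos, sub_add_cancel, Real.rpow_one]

/-- The multiplicative Brunn–Minkowski inequality. -/
lemma satisfiesBrunnMinkowski : SatisfiesBrunnMinkowski μ := by
  have hfin : ∀ n : ℕ, SatisfiesBrunnMinkowski (volume : Measure (Fin n → ℝ)) := by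
    intro n
    induction n with
    | zero => exact satisfiesBrunnMinkowski_of_subsingleton _
    | succ n ih =>
      exact SatisfiesBrunnMinkowski.of_equiv _ ih.prod
        (ContinuousLinearEquiv.ofFinrankEq (by simp [add_comm]))
  exact SatisfiesBrunnMinkowski.of_equiv μ (hfin (Module.finrank ℝ E))
    (ContinuousLinearEquiv.ofFinrankEq (by simp))

end Transfer

end BrunnMinkowski

/-! ### From symmetric marginals in all directions to a centre of symmetry. -/

section Symmetry

open Set Bornology
open scoped Pointwise

variable {E : Type*} [NormedAddCommGroup E] [NormedSpace ℝ E] [MeasurableSpace E] [BorelSpace E]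
  [FiniteDimensional ℝ E] (μ : Measure E) [μ.IsAddHaarMeasure]

lemma exists_symm_of_measure_midpoint_le {A : Set E} (hA : IsOpen A) (hAc : Convex ℝ A)
    (hAb : IsBounded A) (hAne : A.Nonempty)
    (hle : μ ((1 / 2 : ℝ) • A + (1 / 2 : ℝ) • (-A)) ≤ μ A) {u : E →L[ℝ] ℝ} (hu : u ≠ 0) :
    ∃ κ : ℝ, (∀ z ∈ A, κ - u z ∈ u '' A) ∧ 2 * ∫ z in A, u z ∂μ = κ * μ.real A := by
  obtain ⟨v, hv⟩ : ∃ v, u v = 1 := by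
    obtain ⟨x, hx⟩ : ∃ x, u x ≠ 0 := by
      by_contra! h
      exact hu (ContinuousLinearMap.ext h)
    exact ⟨(u x)⁻¹ • x, by simp [hx]⟩
  -- Splitting off the kernel makes `u` the first coordinate, so the result on first marginals
  -- applies.
  let e : E ≃L[ℝ] ℝ × u.ker := ContinuousLinearEquiv.equivOfRightInverse u
    (ContinuousLinearMap.toSpanSingleton ℝ v) fun t => by simp [hv]
  have he : ∀ x, (e x).1 = u x := fun x => ContinuousLinearEquiv.fst_equivOfRightInverse _ _ _ x
  set ν : Measure (ℝ × u.ker) := (volume : Measure ℝ).prod Measure.addHaar with hν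
  obtain ⟨c, hc, hmap⟩ := exists_map_eq_smul μ ν e
  have hc0 : (c : ENNReal) ≠ 0 := by exact_mod_cast hc
  have hneg : e '' (-A) = -(e '' A) := by
    ext y; constructor
    · rintro ⟨x, hx, rfl⟩; exact ⟨-x, hx, by simp⟩
    · rintro ⟨x, hx, hxy⟩; exact ⟨-x, by simpa using hx, by simp [hxy]⟩
  rw [measure_eq_mul_of_map_eq hmap, measure_eq_mul_of_map_eq hmap A,
    ENNReal.mul_le_mul_iff_right hc0 ENNReal.coe_ne_top, image_smul_add_smul, hneg] at hle
  have heA : IsOpen (e '' A) := e.toHomeomorph.isOpenMap _ hA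
  obtain ⟨κ, h1, h2⟩ := (satisfiesBrunnMinkowski (Measure.addHaar : Measure u.ker)).exists_symm_fst
    heA (hAc.linear_image e.toLinearMap) (e.lipschitz.isBounded_image hAb) (hAne.image _) hle
  refine ⟨κ, fun z hz => ?_, ?_⟩
  · obtain ⟨_, ⟨x, hx, rfl⟩, hxz⟩ := h1 (e z) (mem_image_of_mem _ hz)
    rw [he, he] at hxz
    exact ⟨x, hx, hxz⟩
  · have hint : ∫ z in A, u z ∂μ = c * ∫ z in e '' A, z.1 ∂ν := by
      have h3 := e.toHomeomorph.measurableEmbedding.setIntegral_map (μ := μ)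
        (fun z : ℝ × u.ker => z.1) (e '' A)
      have h4 : (e.toHomeomorph : E → ℝ × u.ker) = e := rfl
      rw [h4, hmap, preimage_image_eq _ e.injective, Measure.restrict_smul,
        integral_smul_nnreal_measure] at h3
      simp_rw [he] at h3
      rw [← h3]; rfl
    have hreal : μ.real A = c * ν.real (e '' A) := by
      rw [measureReal_def, measure_eq_mul_of_map_eq hmap, ENNReal.toReal_mul]; rfl
    rw [hint, hreal, mul_left_comm, h2]
    ring

/-- A bounded open convex set `A` whose volume is at least that of `(A - A) / 2` is symmetric. -/
lemma exists_center_of_measure_midpoint_le {A : Set E} (hA : IsOpen A) (hAc : Convex ℝ A)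
    (hAb : IsBounded A) (hAne : A.Nonempty)
    (hle : μ ((1 / 2 : ℝ) • A + (1 / 2 : ℝ) • (-A)) ≤ μ A) :
    ∃ x₀ : E, ∀ y ∈ A, (2 : ℝ) • x₀ - y ∈ A := by
  have hpos : 0 < μ.real A :=
    ENNReal.toReal_pos (hA.measure_pos μ hAne).ne' hAb.measure_lt_top.ne
  -- The centre is the centroid: whatever `u` is, `κ` is then twice its value there.
  refine ⟨(μ.real A)⁻¹ • ∫ z in A, z ∂μ, fun y hy => ?_⟩
  by_contra hcon
  obtain ⟨u, hu⟩ := geometric_hahn_banach_open_point hAc hA hcon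
  have hu0 : u ≠ 0 := by
    rintro rfl
    simpa using hu y hy
  obtain ⟨κ, h1, h2⟩ := exists_symm_of_measure_midpoint_le μ hA hAc hAb hAne hle hu0
  have hint : IntegrableOn (fun z : E => z) A μ :=
    (continuousOn_id.integrableOn_compact hAb.isCompact_closure).mono_set subset_closure
  rw [u.integral_comp_comm hint] at h2
  -- This `x` in `A` has the same `u`-value as the reflected point, contradicting strict separation.
  obtain ⟨x, hx, hxy⟩ := h1 y hy
  have h3 := hu x hx
  rw [hxy, map_sub, map_smul, map_smul, smul_eq_mul, smul_eq_mul, mul_left_comm, h2] at h3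
  have : (μ.real A)⁻¹ * (κ * μ.real A) = κ := by field_simp
  rw [this] at h3
  exact lt_irrefl _ h3

end Symmetry

/-! ### Exhaustion of an open set by inner parallel sets. -/

section Interior

open Set Bornology Metric
open scoped Pointwise

variable {E : Type*} [NormedAddCommGroup E]

/-- The centres of balls of radius larger than `r` contained in `A`. -/
def innerParallel (A : Set E) (r : ℝ) : Set E := {a | ∃ s > r, ball a s ⊆ A}

/-- The strict inequality `s > r` leaves slack: the centre may move by half the gap while the radius
drops by the same amount. -/
lemma isOpen_innerParallel (A : Set E) (r : ℝ) : IsOpen (innerParallel A r) := by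
  rw [Metric.isOpen_iff]
  rintro a ⟨s, hs, ha⟩
  refine ⟨(s - r) / 2, by linarith, fun b hb => ⟨(s + r) / 2, by linarith, ?_⟩⟩
  refine (ball_subset_ball' ?_).trans ha
  rw [mem_ball] at hb
  linarith

lemma ball_subset_of_mem_innerParallel {A : Set E} {r : ℝ} {a : E} (ha : a ∈ innerParallel A r) :
    ball a r ⊆ A := by
  obtain ⟨s, hs, h⟩ := ha
  exact (ball_subset_ball hs.le).trans h

lemma convex_innerParallel [NormedSpace ℝ E] {A : Set E} (hA : Convex ℝ A) (r : ℝ) :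
    Convex ℝ (innerParallel A r) := by
  rintro a ⟨s, hs, ha⟩ b ⟨t, ht, hb⟩ α β hα hβ hαβ
  refine ⟨min s t, lt_min hs ht, fun z hz => ?_⟩
  -- Apply the same displacement to `a` and to `b`, then take the convex combination.
  have hdec : z = α • (a + (z - (α • a + β • b))) + β • (b + (z - (α • a + β • b))) := by
    rw [smul_add, smul_add, add_add_add_comm, ← add_smul, hαβ, one_smul]
    abel
  rw [mem_ball, dist_eq_norm, lt_min_iff] at hz
  rw [hdec]
  exact hA (ha (by simpa using hz.1)) (hb (by simpa using hz.2)) hα hβ hαβ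

lemma innerParallel_anti (A : Set E) : Antitone (innerParallel A) := fun _ _ h _ ⟨s, hs, ha⟩ =>
  ⟨s, h.trans_lt hs, ha⟩

lemma iUnion_innerParallel {A : Set E} (hA : IsOpen A) :
    ⋃ n : ℕ, innerParallel A (1 / ((n : ℝ) + 1)) = A := by
  refine Subset.antisymm (iUnion_subset fun n a ha => ?_) fun a ha => ?_
  · exact ball_subset_of_mem_innerParallel ha (mem_ball_self (by positivity))
  · obtain ⟨s, hs, h⟩ := Metric.isOpen_iff.mp hA a ha
    obtain ⟨n, hn⟩ := exists_nat_one_div_lt hs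
    exact mem_iUnion.mpr ⟨n, s, hn, h⟩

end Interior

/-! ### The volume bound for the difference body, and the conclusion. -/

section Spectral

open Set Metric
open scoped Pointwise

variable {d : ℕ}

lemma IsSpectralPair.volume_midpoint_le_one {Ω Λ : Set (EuclideanSpace ℝ (Fin d))}
    (hopen : IsOpen Ω) (hconv : Convex ℝ Ω) (hbdd : Bornology.IsBounded Ω)
    (h : IsSpectralPair Ω Λ) : volume ((1 / 2 : ℝ) • Ω + (1 / 2 : ℝ) • (-Ω)) ≤ 1 := by
  set U : ℕ → Set (EuclideanSpace ℝ (Fin d)) := fun n => innerParallel Ω (1 / ((n : ℝ) + 1))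
    with hU
  have hUsub : ∀ n, U n ⊆ Ω := fun n a ha =>
    ball_subset_of_mem_innerParallel ha (mem_ball_self (by positivity))
  have hUmono : Monotone U := fun m n hmn =>
    innerParallel_anti Ω (one_div_le_one_div_of_le (by positivity) (by gcongr))
  set K : ℕ → Set (EuclideanSpace ℝ (Fin d)) := fun n => (1 / 2 : ℝ) • U n + (1 / 2 : ℝ) • (-U n)
    with hK
  have hKmono : Monotone K := fun m n hmn => add_subset_add (smul_set_mono (hUmono hmn))
    (smul_set_mono (neg_subset_neg.mpr (hUmono hmn)))
  have hKU : (1 / 2 : ℝ) • Ω + (1 / 2 : ℝ) • (-Ω) = ⋃ n, K n := by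
    refine Subset.antisymm ?_ (iUnion_subset fun n => add_subset_add (smul_set_mono (hUsub n))
      (smul_set_mono (neg_subset_neg.mpr (hUsub n))))
    rintro _ ⟨_, ⟨a, ha, rfl⟩, _, ⟨b, hb, rfl⟩, rfl⟩
    rw [← iUnion_innerParallel hopen] at ha
    rw [mem_neg, ← iUnion_innerParallel hopen] at hb
    obtain ⟨m, hm⟩ := mem_iUnion.mp ha
    obtain ⟨n, hn⟩ := mem_iUnion.mp hb
    refine mem_iUnion.mpr ⟨max m n, ?_⟩
    exact add_mem_add (smul_mem_smul_set (hUmono (le_max_left m n) hm))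
      (smul_mem_smul_set (mem_neg.mpr (hUmono (le_max_right m n) hn)))
  rw [hKU, hKmono.measure_iUnion]
  refine iSup_le fun n => ?_
  have hKb : Bornology.IsBounded (K n) :=
    IsBounded.smul_add_smul (hbdd.subset (hUsub n)) (hbdd.subset (hUsub n)).neg _ _
  have hKo : IsOpen (K n) := (isOpen_innerParallel _ _).smul_add_smul (by norm_num) _
  have hreal := h.volume_real_le_one hbdd.measure_lt_top.ne
    (r := 1 / ((n : ℝ) + 1)) (by positivity) hKb.measure_lt_top.ne ?_ hKo.measurableSet
  · rw [← ENNReal.ofReal_toReal hKb.measure_lt_top.ne, ← ENNReal.ofReal_one]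
    exact ENNReal.ofReal_le_ofReal hreal
  · rintro _ ⟨_, ⟨a, ha, rfl⟩, _, ⟨b, hb, rfl⟩, rfl⟩ _ ⟨_, ⟨a', ha', rfl⟩, _, ⟨b', hb', rfl⟩, rfl⟩
    have hc := convex_innerParallel hconv (1 / ((n : ℝ) + 1))
    -- Regrouping the four points writes the difference of two points of `K n` as a difference of
    -- two midpoints of points of `U n`, which lie in `U n` by convexity.
    refine ⟨(1 / 2 : ℝ) • (-b) + (1 / 2 : ℝ) • a', (1 / 2 : ℝ) • a + (1 / 2 : ℝ) • (-b'),
      ball_subset_of_mem_innerParallel (hc hb ha' (by norm_num) (by norm_num) (by norm_num)),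
      ball_subset_of_mem_innerParallel (hc ha hb' (by norm_num) (by norm_num) (by norm_num)), ?_⟩
    simp only
    module

end Spectral

theorem theorem1 (d : ℕ) (Ω : Set (EuclideanSpace ℝ (Fin d)))
    (hopen : IsOpen Ω) (hconv : Convex ℝ Ω) (hbdd : Bornology.IsBounded Ω)
    (hvol : volume Ω = 1) (hns : IsNonSymmetric Ω) :
    ¬ IsSpectral Ω := by
  rintro ⟨Λ, hΛ⟩
  have hne : Ω.Nonempty := by
    by_contra h
    rw [Set.not_nonempty_iff_eq_empty] at h
    simp [h] at hvol
  obtain ⟨x₀, hx₀⟩ := exists_center_of_measure_midpoint_le volume hopen hconv hbdd hne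
    ((hΛ.volume_midpoint_le_one hopen hconv hbdd).trans hvol.ge)
  exact hns x₀ hx₀
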